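/- Let $n\ge 0$ and write $[n]=\{1,\dots,n\}$. For $i\in[n]$ let $W_i\subset\mathbb R^n$ be a nonempty finite set with convex hull $P_i$, let $\mu_i:W_i\to\mathbb R$ be a function, and let $\hat P_i\subset\mathbb R^{n}\times\mathbb R$ be the convex hull of the points $(w,\mu_i(w))$, $w\in W_i$. For $I\subset[n]$ put $P_I=\sum_{i\in I}P_i$ and $\hat P_I=\sum_{i\in I}\hat P_i$ (Minkowski sums, equal to $\{0\}$ when $I=\emptyset$). A lower face of a polytope in $\mathbb R^n\times\mathbb R$ is the set of its points where a linear function $\langle(u,1),\cdot\rangle$ with $u\in\mathbb R^n$ attains its minimum on the polytope. The convex mixed subdivision $\mathcal S_I$ of $P_I$ associated with $(\mu_i)_{i\in I}$ is the set of the images of all lower faces of $\hat P_I$ under the projection $\pi:\mathbb R^n\times\mathbb R\to\mathbb R^n$, and $\mathcal V_I$ denotes its set of vertices, that is, the set of all $v$ with $\{v\}\in\mathcal S_I$; in particular $|\mathcal V_\emptyset|=1$. Put $\mathcal S=\mathcal S_{[n]}$. A polytope $Q\in\mathcal S$ that is the projection of the lower face of $\hat P_{[n]}$ defined by $u$ is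 written $Q=Q_1+\cdots+Q_n$, where $Q_i$ is the projection of the lower face of $\hat P_i$ defined by the same $u$. Suppose that $\mathcal S$ is pure, that is, $\dim Q=\dim Q_1+\cdots+\dim Q_n$ for every $Q=Q_1+\cdots+Q_n\in\mathcal S$. Call $Q=Q_1+\cdots+Q_n\in\mathcal S$ a mixed polytope of $\mathcal S$ if $\dim Q=\dim Q_1+\cdots+\dim Q_n$ and $\dim Q_i\ge 1$ for all $i$ (equivalently, $Q$ is $n$-dimensional and every $Q_i$ is a segment). Then the sets $\mathcal V_I$ and the set of mixed polytopes of $\mathcal S$ are finite, and $$\sum_{I\subset[n]}(-1)^{n-|I|}\,|\mathcal V_I|$$ is equal to the number of mixed polytopes of $\mathcal S$. -/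

import Mathlib

open scoped Pointwise

noncomputable section

namespace MixedSubdivision

/-- The lifted polytope `P̂ ⊆ ℝⁿ × ℝ` of a function `μ` on a finite set `W ⊆ ℝⁿ`: the convex hull
of the points `(w, μ w)` for `w ∈ W`. -/
def liftedPolytope {n : ℕ} (W : Finset (EuclideanSpace ℝ (Fin n))) (μ : W → ℝ) :
    Set (EuclideanSpace ℝ (Fin n) × ℝ) :=
  convexHull ℝ (Set.range fun w : W => ((w : EuclideanSpace ℝ (Fin n)), μ w))

/-- The lower face of `A ⊆ ℝⁿ × ℝ` with inward normal vector `(u, 1)`: the set of all points of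
`A` where the linear function `⟨(u, 1), ·⟩` attains its minimum on `A`. Up to positive scaling, the
vectors `(u, 1)` are exactly the vectors whose last coordinate is positive. -/
def lowerFace {n : ℕ} (A : Set (EuclideanSpace ℝ (Fin n) × ℝ)) (u : EuclideanSpace ℝ (Fin n)) :
    Set (EuclideanSpace ℝ (Fin n) × ℝ) :=
  {x | x ∈ A ∧ ∀ y ∈ A, inner ℝ u x.1 + x.2 ≤ inner ℝ u y.1 + y.2}

/-- The image under the vertical projection `ℝⁿ × ℝ → ℝⁿ` of the lower face of `A` with inward
normal vector `(u, 1)`. -/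
def projFace {n : ℕ} (A : Set (EuclideanSpace ℝ (Fin n) × ℝ)) (u : EuclideanSpace ℝ (Fin n)) :
    Set (EuclideanSpace ℝ (Fin n)) :=
  Prod.fst '' lowerFace A u

/-- The dimension of a (nonempty) subset of `ℝⁿ`: the dimension of its affine span. -/
def polyDim {n : ℕ} (Q : Set (EuclideanSpace ℝ (Fin n))) : ℕ :=
  Module.finrank ℝ (affineSpan ℝ Q).direction

/-- The Minkowski sum `∑_{i ∈ I} P̂_i` of lifted polytopes; it is `{0}` for `I = ∅`. -/
def liftedSum {n r : ℕ} (W : Fin r → Finset (EuclideanSpace ℝ (Fin n))) (μ : ∀ i, W i → ℝ)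
    (I : Finset (Fin r)) : Set (EuclideanSpace ℝ (Fin n) × ℝ) :=
  ∑ i ∈ I, liftedPolytope (W i) (μ i)

/-- The convex mixed subdivision `S_I` of `P_I = ∑_{i ∈ I} P_i`, with `P_i = conv (W i)`, associated
with the functions `μ i`, `i ∈ I`: the set of the projections of all lower faces of
`∑_{i ∈ I} P̂_i`. -/
def subdivision {n r : ℕ} (W : Fin r → Finset (EuclideanSpace ℝ (Fin n))) (μ : ∀ i, W i → ℝ)
    (I : Finset (Fin r)) : Set (Set (EuclideanSpace ℝ (Fin n))) :=
  {Q | ∃ u, Q = projFace (liftedSum W μ I) u}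

/-- The set `V_I` of vertices of the subdivision `S_I`. -/
def vertexSet {n r : ℕ} (W : Fin r → Finset (EuclideanSpace ℝ (Fin n))) (μ : ∀ i, W i → ℝ)
    (I : Finset (Fin r)) : Set (EuclideanSpace ℝ (Fin n)) :=
  {v | {v} ∈ subdivision W μ I}

/-- `Q` is a polytope of the mixed subdivision `S` of `P_1 + ⋯ + P_r`, and `Q = Q_1 + ⋯ + Q_r` is
its privileged writing: for some `u`, the polytopes `Q` and `Q_i` are the projections of
the lower faces of `P̂_1 + ⋯ + P̂_r` and of `P̂_i` with the same inward normal vector `(u, 1)`. -/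
def IsCellWithSummands {n r : ℕ} (W : Fin r → Finset (EuclideanSpace ℝ (Fin n)))
    (μ : ∀ i, W i → ℝ) (Q : Set (EuclideanSpace ℝ (Fin n)))
    (Qs : Fin r → Set (EuclideanSpace ℝ (Fin n))) : Prop :=
  ∃ u, Q = projFace (liftedSum W μ Finset.univ) u ∧
    ∀ i, Qs i = projFace (liftedPolytope (W i) (μ i)) u

/-- The mixed subdivision of `P_1 + ⋯ + P_r` associated with `(μ_1, …, μ_r)` is pure:
`dim Q = dim Q_1 + ⋯ + dim Q_r` for each of its polytopes `Q = Q_1 + ⋯ + Q_r`. -/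
def IsPure {n r : ℕ} (W : Fin r → Finset (EuclideanSpace ℝ (Fin n))) (μ : ∀ i, W i → ℝ) : Prop :=
  ∀ Q Qs, IsCellWithSummands W μ Q Qs → polyDim Q = ∑ i, polyDim (Qs i)

/-- The mixed polytopes of the mixed subdivision of `P_1 + ⋯ + P_r`: its polytopes
`Q = Q_1 + ⋯ + Q_r` with `dim Q = dim Q_1 + ⋯ + dim Q_r` and `dim Q_i ≥ 1` for all `i`. -/
def mixedPolytopes {n r : ℕ} (W : Fin r → Finset (EuclideanSpace ℝ (Fin n)))
    (μ : ∀ i, W i → ℝ) : Set (Set (EuclideanSpace ℝ (Fin n))) :=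
  {Q | ∃ Qs, IsCellWithSummands W μ Q Qs ∧ polyDim Q = ∑ i, polyDim (Qs i) ∧
    ∀ i, 1 ≤ polyDim (Qs i)}

end MixedSubdivision

end

/-! The proof counts in the dual space of normal vectors `u`. Let `T_i` be the tropical hypersurface
where the minimum of `⟨u, w⟩ + μ_i w` over `W_i` is not attained uniquely. The vertices of `S_I`
correspond to the nonempty regions of the complement of `⋃_{i ∈ I} T_i`, which are open and convex
(`vertexSet_eq_image`, `injOn_sum_region`).

Each such region has compactly supported Euler characteristic `(-1)^n`. This characteristic is
additive under cutting by hyperplanes (`eulerChar_eq_sum_arrangement`), so everything may be cut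
along the arrangement of all walls between lifted points. On each face of the arrangement, expanding
`∏ (1 - 1_{complement of T_i}) = ∏ 1_{T_i}` turns the alternating sum over `I` into the contribution
of `⋂ T_i` (`sum_eulerChar_region_inter`).

Purity makes the cell dual to a point of `⋂ T_i` full-dimensional, and such a cell determines its
normal vector. Hence `⋂ T_i` consists of isolated faces that are points, each contributing `1`, and
these points biject with the mixed polytopes. -/

namespace MixedSubdivision

/-! ### Additivity of the compactly supported Euler characteristic. -/

section Euler

variable {E : Type*} [NormedAddCommGroup E] [NormedSpace ℝ E]

/-- A set which is a relatively open convex subset of an affine subspace. -/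
def IsRelOpenConvex (S : Set E) : Prop :=
  ∃ (A : AffineSubspace ℝ E) (U : Set E), IsOpen U ∧ Convex ℝ U ∧ S = (A : Set E) ∩ U

open scoped Classical in
/-- The Euler characteristic with compact supports of a relatively open convex set. -/
noncomputable def eulerChar (S : Set E) : ℤ :=
  if S.Nonempty then (-1) ^ Module.finrank ℝ (affineSpan ℝ S).direction else 0

lemma eulerChar_empty : eulerChar (∅ : Set E) = 0 := by
  simp [eulerChar]

lemma eulerChar_singleton (p : E) : eulerChar ({p} : Set E) = 1 := by
  rw [eulerChar, if_pos (Set.singleton_nonempty p), direction_affineSpan, vectorSpan_singleton]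
  simp

/-- Through a point of a relatively open set, small moves in both directions stay in the set. -/
lemma exists_lineMap_mem {A : AffineSubspace ℝ E} {U : Set E} (hU : IsOpen U) {p q : E}
    (hp : p ∈ (A : Set E) ∩ U) (hq : q ∈ A) :
    ∃ ε : ℝ, 0 < ε ∧ AffineMap.lineMap p q ε ∈ (A : Set E) ∩ U ∧
      AffineMap.lineMap p q (-ε) ∈ (A : Set E) ∩ U := by
  have hc : Continuous fun t : ℝ => (AffineMap.lineMap p q t : E) := AffineMap.lineMap_continuous
  have hV : IsOpen ((fun t : ℝ => (AffineMap.lineMap p q t : E)) ⁻¹' U) := hU.preimage hc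
  obtain ⟨δ, hδ, hball⟩ := Metric.isOpen_iff.1 hV 0 (by simpa using hp.2)
  refine ⟨δ / 2, by positivity, ⟨AffineMap.lineMap_mem _ hp.1 hq, hball ?_⟩,
    ⟨AffineMap.lineMap_mem _ hp.1 hq, hball ?_⟩⟩ <;>
  · simp only [Metric.mem_ball, Real.dist_eq, sub_zero, abs_neg]
    rw [abs_of_pos (by positivity)]
    linarith

lemma affineSpan_inter_isOpen {A : AffineSubspace ℝ E} {U : Set E} (hU : IsOpen U)
    (hne : ((A : Set E) ∩ U).Nonempty) : affineSpan ℝ ((A : Set E) ∩ U) = A := by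
  refine le_antisymm (affineSpan_le.2 Set.inter_subset_left) fun q hq => ?_
  obtain ⟨p, hp⟩ := hne
  obtain ⟨ε, hε, h₁, -⟩ := exists_lineMap_mem hU hp hq
  have h := AffineMap.lineMap_mem ε⁻¹ (subset_affineSpan ℝ _ hp) (subset_affineSpan ℝ _ h₁)
  rwa [AffineMap.lineMap_lineMap_right, inv_mul_cancel₀ hε.ne', AffineMap.lineMap_apply_one] at h

lemma eulerChar_inter_isOpen {A : AffineSubspace ℝ E} {U : Set E} (hU : IsOpen U)
    (hne : ((A : Set E) ∩ U).Nonempty) :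
    eulerChar ((A : Set E) ∩ U) = (-1) ^ Module.finrank ℝ A.direction := by
  rw [eulerChar, if_pos hne, affineSpan_inter_isOpen hU hne]

lemma eulerChar_of_isOpen {U : Set E} (hU : IsOpen U) (hne : U.Nonempty) :
    eulerChar U = (-1) ^ Module.finrank ℝ E := by
  have h := eulerChar_inter_isOpen (A := ⊤) hU (by simpa using hne)
  rwa [AffineSubspace.top_coe, Set.univ_inter, AffineSubspace.direction_top, finrank_top] at h

/-- The zero set of an affine function. -/
noncomputable def zeroSubspace (h : E →ᵃ[ℝ] ℝ) : AffineSubspace ℝ E :=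
  (affineSpan ℝ {(0 : ℝ)}).comap h

lemma mem_zeroSubspace {h : E →ᵃ[ℝ] ℝ} {x : E} : x ∈ zeroSubspace h ↔ h x = 0 := by
  simp [zeroSubspace, AffineSubspace.mem_comap]

/-- The points where an affine function has a given sign. -/
def signSet (h : E →ᵃ[ℝ] ℝ) (s : SignType) : Set E := {x | SignType.sign (h x) = s}

lemma convex_signSet (h : E →ᵃ[ℝ] ℝ) (s : SignType) : Convex ℝ (signSet h s) := by
  cases s
  · have : signSet h SignType.zero = h ⁻¹' {0} := by
      ext; exact sign_eq_zero_iff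
    rw [this]; exact (convex_singleton _).affine_preimage h
  · have : signSet h SignType.neg = h ⁻¹' Set.Iio 0 := by
      ext; exact sign_eq_neg_one_iff
    rw [this]; exact (convex_Iio _).affine_preimage h
  · have : signSet h SignType.pos = h ⁻¹' Set.Ioi 0 := by
      ext; exact sign_eq_one_iff
    rw [this]; exact (convex_Ioi _).affine_preimage h

variable [FiniteDimensional ℝ E]

/-- The direction of the intersection is the kernel of the linear part of `h` on `A.direction`, a
functional that is nonzero on `q - p`. -/
lemma finrank_direction_inf_zeroSubspace {A : AffineSubspace ℝ E} {h : E →ᵃ[ℝ] ℝ} {p q : E}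
    (hp : p ∈ A) (hq : q ∈ A) (hp0 : h p = 0) (hq0 : h q ≠ 0) :
    Module.finrank ℝ (A ⊓ zeroSubspace h).direction + 1 = Module.finrank ℝ A.direction := by
  have hpB : p ∈ A ⊓ zeroSubspace h := ⟨hp, mem_zeroSubspace.2 hp0⟩
  have hdir : (A ⊓ zeroSubspace h).direction = A.direction ⊓ LinearMap.ker h.linear := by
    ext v
    rw [← AffineSubspace.vadd_mem_iff_mem_direction v hpB, AffineSubspace.mem_inf_iff,
      AffineSubspace.vadd_mem_iff_mem_direction v hp, mem_zeroSubspace, AffineMap.map_vadd, hp0,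
      Submodule.mem_inf, LinearMap.mem_ker]
    simp
  have hne : h.linear.domRestrict A.direction ≠ 0 := by
    intro h0
    apply hq0
    have h1 := LinearMap.congr_fun h0 ⟨q -ᵥ p, AffineSubspace.vsub_mem_direction hq hp⟩
    rw [LinearMap.domRestrict_apply, AffineMap.linearMap_vsub, hp0] at h1
    simpa using h1
  rw [← Module.Dual.finrank_ker_add_one_of_ne_zero hne, hdir, LinearMap.ker_domRestrict,
    ← Submodule.map_comap_subtype, Submodule.finrank_map_subtype_eq]

lemma continuous_affine (h : E →ᵃ[ℝ] ℝ) : Continuous h :=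
  AffineMap.continuous_of_finiteDimensional h

lemma isOpen_signSet {h : E →ᵃ[ℝ] ℝ} {s : SignType} (hs : s ≠ 0) : IsOpen (signSet h s) := by
  have hc := continuous_affine h
  cases s
  · exact absurd rfl hs
  · simpa [signSet, sign_eq_neg_one_iff] using isOpen_lt hc continuous_const
  · simpa [signSet, sign_eq_one_iff] using isOpen_lt continuous_const hc

lemma IsRelOpenConvex.inter_signSet {S : Set E} (hS : IsRelOpenConvex S) (h : E →ᵃ[ℝ] ℝ)
    (s : SignType) : IsRelOpenConvex (S ∩ signSet h s) := by
  obtain ⟨A, U, hU, hUc, rfl⟩ := hS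
  by_cases hs : s = 0
  · subst hs
    refine ⟨A ⊓ zeroSubspace h, U, hU, hUc, ?_⟩
    ext x
    simp [signSet, AffineSubspace.mem_inf_iff, mem_zeroSubspace]
    tauto
  · exact ⟨A, U ∩ signSet h s, hU.inter (isOpen_signSet hs), hUc.inter (convex_signSet h s),
      Set.inter_assoc _ _ _⟩

/-- Cutting a relatively open convex set by a hyperplane preserves the Euler characteristic. -/
lemma eulerChar_eq_sum_signSet {S : Set E} (hS : IsRelOpenConvex S) (h : E →ᵃ[ℝ] ℝ) :
    eulerChar S = ∑ s : SignType, eulerChar (S ∩ signSet h s) := by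
  obtain ⟨A, U, hU, hUc, rfl⟩ := hS
  set S := (A : Set E) ∩ U with hSdef
  have hSc : Convex ℝ S := A.convex.inter hUc
  -- If `h` has constant sign on `S`, two of the three pieces are empty.
  have single : ∀ s, S ⊆ signSet h s →
      eulerChar S = ∑ s : SignType, eulerChar (S ∩ signSet h s) := by
    intro s hs
    rw [Finset.sum_eq_single s, Set.inter_eq_left.2 hs]
    · intro t _ hts
      have : S ∩ signSet h t = ∅ := by
        ext x
        simp only [Set.mem_inter_iff, Set.mem_empty_iff_false, iff_false, not_and]
        exact fun hx hx' => hts (hx'.symm.trans (hs hx))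
      rw [this, eulerChar_empty]
    · simp
  by_cases hzero : ∃ p ∈ S, h p = 0
  · obtain ⟨p, hp, hp0⟩ := hzero
    by_cases hall : ∀ q ∈ A, h q = 0
    · exact single 0 fun x hx => by simp [signSet, hall x hx.1]
    · push Not at hall
      obtain ⟨q, hq, hq0⟩ := hall
      obtain ⟨ε, hε, h₁, h₂⟩ := exists_lineMap_mem hU hp hq
      have e : ∀ t : ℝ, h (AffineMap.lineMap p q t) = t * h q := by
        intro t
        rw [AffineMap.apply_lineMap, hp0, AffineMap.lineMap_apply]
        simp
      -- On the line through `p` and `q` the value of `h` is `t * h q`, so the parameters `ε` and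
      -- `-ε` realize both signs inside `S`.
      have hsgn : ∀ s : SignType, s ≠ 0 → (S ∩ signSet h s).Nonempty := by
        intro s hs
        rcases lt_or_gt_of_ne hq0 with hlt | hgt <;> cases s
        · exact absurd rfl hs
        · exact ⟨_, h₁, by rw [signSet, Set.mem_ofPred_eq, e]
                           exact sign_eq_neg_one_iff.2 (by nlinarith)⟩
        · exact ⟨_, h₂, by rw [signSet, Set.mem_ofPred_eq, e]
                           exact sign_eq_one_iff.2 (by nlinarith)⟩
        · exact absurd rfl hs
        · exact ⟨_, h₂, by rw [signSet, Set.mem_ofPred_eq, e]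
                           exact sign_eq_neg_one_iff.2 (by nlinarith)⟩
        · exact ⟨_, h₁, by rw [signSet, Set.mem_ofPred_eq, e]
                           exact sign_eq_one_iff.2 (by nlinarith)⟩
      have hopen : ∀ s : SignType, s ≠ 0 →
          eulerChar (S ∩ signSet h s) = (-1) ^ Module.finrank ℝ A.direction := by
        intro s hs
        have hn := hsgn s hs
        rw [hSdef, Set.inter_assoc] at hn ⊢
        exact eulerChar_inter_isOpen (hU.inter (isOpen_signSet hs)) hn
      have hz : eulerChar (S ∩ signSet h 0) = - (-1) ^ Module.finrank ℝ A.direction := by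
        have hS0 : S ∩ signSet h 0 = ((A ⊓ zeroSubspace h : AffineSubspace ℝ E) : Set E) ∩ U := by
          ext x
          simp [hSdef, signSet, AffineSubspace.mem_inf_iff, mem_zeroSubspace]
          tauto
        rw [hS0, eulerChar_inter_isOpen hU
            ⟨p, (AffineSubspace.mem_inf_iff _ _ _).2 ⟨hp.1, mem_zeroSubspace.2 hp0⟩, hp.2⟩,
          ← finrank_direction_inf_zeroSubspace hp.1 hq hp0 hq0, pow_succ]
        ring
      have hsum : ∀ f : SignType → ℤ, ∑ s, f s = f 0 + f (-1) + f 1 := by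
        intro f
        have : (Finset.univ : Finset SignType) = {0, -1, 1} := rfl
        rw [this]
        simp [add_assoc]
      -- With `e = (-1) ^ dim A`, the three pieces give `-e + e + e = e`.
      rw [hsum, hz, hopen _ (by decide), hopen _ (by decide), hSdef,
        eulerChar_inter_isOpen hU ⟨p, hp⟩]
      ring
  · push Not at hzero
    rcases S.eq_empty_or_nonempty with hemp | ⟨p, hp⟩
    · rw [hemp]
      simp [eulerChar_empty]
    -- Two different signs on the connected set `S` would force a zero of `h`.
    · have himg : IsPreconnected (h '' S) :=
        hSc.isPreconnected.image _ (continuous_affine h).continuousOn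
      refine single (SignType.sign (h p)) fun x hx => ?_
      rw [signSet, Set.mem_ofPred_eq]
      by_contra hne
      have hx0 := hzero x hx
      have hp0 := hzero p hp
      have : (0 : ℝ) ∈ h '' S := by
        rcases lt_or_gt_of_ne hx0 with h1 | h1 <;> rcases lt_or_gt_of_ne hp0 with h2 | h2
        · exact absurd ((sign_neg h1).trans (sign_neg h2).symm) hne
        · exact himg.Icc_subset ⟨x, hx, rfl⟩ ⟨p, hp, rfl⟩ ⟨h1.le, h2.le⟩
        · exact himg.Icc_subset ⟨p, hp, rfl⟩ ⟨x, hx, rfl⟩ ⟨h2.le, h1.le⟩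
        · exact absurd ((sign_pos h1).trans (sign_pos h2).symm) hne
      obtain ⟨y, hy, hy0⟩ := this
      exact hzero y hy hy0

lemma eulerChar_eq_sum_arrangement_fin {m : ℕ} (h : Fin m → (E →ᵃ[ℝ] ℝ)) {S : Set E}
    (hS : IsRelOpenConvex S) :
    eulerChar S = ∑ σ : Fin m → SignType, eulerChar (S ∩ ⋂ i, signSet (h i) (σ i)) := by
  induction m generalizing S with
  | zero => simp
  | succ m ih =>
    rw [eulerChar_eq_sum_signSet hS (h 0), ← (Fin.consEquiv fun _ => SignType).sum_comp,
      Fintype.sum_prod_type]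
    refine Finset.sum_congr rfl fun s _ => ?_
    rw [ih (fun i => h i.succ) (hS.inter_signSet (h 0) s)]
    refine Finset.sum_congr rfl fun σ _ => congrArg _ ?_
    ext x
    simp [Fin.forall_fin_succ, Fin.consEquiv, and_assoc]

/-- Cutting a relatively open convex set by the faces of a hyperplane arrangement preserves the
Euler characteristic. -/
lemma eulerChar_eq_sum_arrangement {ι : Type*} [Fintype ι] [DecidableEq ι] (h : ι → (E →ᵃ[ℝ] ℝ))
    {S : Set E} (hS : IsRelOpenConvex S) :
    eulerChar S = ∑ σ : ι → SignType, eulerChar (S ∩ {x | ∀ i, SignType.sign (h i x) = σ i}) := by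
  let e := Fintype.equivFin ι
  rw [eulerChar_eq_sum_arrangement_fin (fun j => h (e.symm j)) hS,
    ← (Equiv.arrowCongr e (Equiv.refl SignType)).sum_comp]
  refine Finset.sum_congr rfl fun σ _ => congrArg _ ?_
  ext x
  simp only [Set.mem_inter_iff, Set.mem_iInter, signSet, Set.mem_ofPred_eq, Equiv.arrowCongr_apply,
    Equiv.coe_refl, Function.comp_apply, id]
  rw [← e.symm.forall_congr_right (q := fun i => SignType.sign (h i x) = σ i)]

end Euler

end MixedSubdivision

namespace MixedSubdivision

/-! ### Projected lower faces, Minkowski sums and normal vectors. -/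

section Faces

variable {n : ℕ}

/-- A linear function on a Minkowski sum is minimal exactly when it is minimal in each summand
separately. -/
lemma lowerFace_add (A B : Set (EuclideanSpace ℝ (Fin n) × ℝ)) (u : EuclideanSpace ℝ (Fin n)) :
    lowerFace (A + B) u = lowerFace A u + lowerFace B u := by
  ext x
  constructor
  · rintro ⟨hx, hmin⟩
    obtain ⟨a, ha, b, hb, rfl⟩ := Set.mem_add.1 hx
    refine Set.add_mem_add ⟨ha, fun y hy => ?_⟩ ⟨hb, fun y hy => ?_⟩
    · have := hmin _ (Set.add_mem_add hy hb)
      simp only [Prod.fst_add, Prod.snd_add, inner_add_right] at this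
      linarith
    · have := hmin _ (Set.add_mem_add ha hy)
      simp only [Prod.fst_add, Prod.snd_add, inner_add_right] at this
      linarith
  · intro hx
    obtain ⟨a, ⟨ha, hamin⟩, b, ⟨hb, hbmin⟩, rfl⟩ := Set.mem_add.1 hx
    refine ⟨Set.add_mem_add ha hb, fun y hy => ?_⟩
    obtain ⟨a', ha', b', hb', rfl⟩ := Set.mem_add.1 hy
    have h₁ := hamin a' ha'
    have h₂ := hbmin b' hb'
    simp only [Prod.fst_add, Prod.snd_add, inner_add_right]
    linarith

lemma projFace_add (A B : Set (EuclideanSpace ℝ (Fin n) × ℝ)) (u : EuclideanSpace ℝ (Fin n)) :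
    projFace (A + B) u = projFace A u + projFace B u := by
  rw [projFace, lowerFace_add]
  exact Set.image_add (AddMonoidHom.fst (EuclideanSpace ℝ (Fin n)) ℝ)

lemma projFace_zero (u : EuclideanSpace ℝ (Fin n)) :
    projFace (0 : Set (EuclideanSpace ℝ (Fin n) × ℝ)) u = 0 := by
  ext x
  simp only [projFace, lowerFace, Set.mem_image, Set.mem_zero]
  constructor
  · rintro ⟨y, ⟨rfl, -⟩, rfl⟩
    rfl
  · rintro rfl
    exact ⟨0, ⟨rfl, by rintro y rfl; exact le_rfl⟩, rfl⟩

lemma projFace_sum {ι : Type*} (I : Finset ι) (A : ι → Set (EuclideanSpace ℝ (Fin n) × ℝ))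
    (u : EuclideanSpace ℝ (Fin n)) :
    projFace (∑ i ∈ I, A i) u = ∑ i ∈ I, projFace (A i) u := by
  classical
  induction I using Finset.induction_on with
  | empty => simpa using projFace_zero u
  | insert i I hi ih => rw [Finset.sum_insert hi, Finset.sum_insert hi, projFace_add, ih]

lemma convex_projFace {A : Set (EuclideanSpace ℝ (Fin n) × ℝ)} (hA : Convex ℝ A)
    (u : EuclideanSpace ℝ (Fin n)) : Convex ℝ (projFace A u) := by
  have h : Convex ℝ (lowerFace A u) := by
    intro x hx y hy a b ha hb hab
    refine ⟨hA hx.1 hy.1 ha hb hab, fun z hz => ?_⟩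
    have h₁ := hx.2 z hz
    have h₂ := hy.2 z hz
    simp only [Prod.fst_add, Prod.snd_add, Prod.smul_fst, Prod.smul_snd, inner_add_right,
      inner_smul_right, smul_eq_mul]
    have hb' : b = 1 - a := by linarith
    subst hb'
    nlinarith [mul_le_mul_of_nonneg_left h₁ ha, mul_le_mul_of_nonneg_left h₂ hb]
  exact h.linear_image (LinearMap.fst ℝ _ ℝ)

/-- Two normal vectors with the same projected lower face differ by a vector orthogonal to it. -/
lemma inner_sub_eq_of_projFace_eq {A : Set (EuclideanSpace ℝ (Fin n) × ℝ)}
    {u u' x y : EuclideanSpace ℝ (Fin n)} (h : projFace A u = projFace A u')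
    (hx : x ∈ projFace A u) (hy : y ∈ projFace A u) : inner ℝ (u - u') (x - y) = 0 := by
  have hx' := h ▸ hx
  have hy' := h ▸ hy
  obtain ⟨a, ⟨ha, hamin⟩, rfl⟩ := hx
  obtain ⟨b, ⟨hb, hbmin⟩, rfl⟩ := hy
  obtain ⟨a', ⟨ha', hamin'⟩, haa⟩ := hx'
  obtain ⟨b', ⟨hb', hbmin'⟩, hbb⟩ := hy'
  have h₁ := hamin a' ha'
  have h₂ := hbmin b' hb'
  have h₃ := hamin' a ha
  have h₄ := hbmin' b hb
  have h₅ := hamin b hb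
  have h₆ := hbmin a ha
  have h₇ := hamin' b' hb'
  have h₈ := hbmin' a' ha'
  rw [haa] at h₁ h₃ h₇ h₈
  rw [hbb] at h₂ h₄ h₇ h₈
  rw [inner_sub_left, inner_sub_right, inner_sub_right]
  linarith

/-- The difference `u - u'` is orthogonal to all differences of points of the face; these span `ℝⁿ`,
so it is orthogonal to itself. -/
lemma eq_of_projFace_eq {A : Set (EuclideanSpace ℝ (Fin n) × ℝ)}
    {u u' : EuclideanSpace ℝ (Fin n)} (h : projFace A u = projFace A u')
    (hdim : n ≤ polyDim (projFace A u)) : u = u' := by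
  have htop : vectorSpan ℝ (projFace A u) = ⊤ := by
    refine Submodule.eq_top_of_finrank_eq (le_antisymm (Submodule.finrank_le _) ?_)
    rw [finrank_euclideanSpace_fin, ← direction_affineSpan]
    exact hdim
  have hle : vectorSpan ℝ (projFace A u) ≤ LinearMap.ker (innerₛₗ ℝ (u - u')) := by
    refine Submodule.span_le.2 ?_
    rintro _ ⟨x, hx, y, hy, rfl⟩
    exact inner_sub_eq_of_projFace_eq h hx hy
  have hmem : u - u' ∈ LinearMap.ker (innerₛₗ ℝ (u - u')) := hle (htop ▸ Submodule.mem_top)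
  exact sub_eq_zero.1 (inner_self_eq_zero.1 hmem)

lemma one_le_polyDim_iff {Q : Set (EuclideanSpace ℝ (Fin n))} :
    1 ≤ polyDim Q ↔ ¬ Q.Subsingleton := by
  rw [polyDim, direction_affineSpan, Nat.one_le_iff_ne_zero, not_iff_not,
    Submodule.finrank_eq_zero, vectorSpan_eq_bot_iff_subsingleton]

end Faces

/-! ### Faces of one lifted polytope and unique minimizers. -/

section SinglePolytope

variable {n : ℕ} (W : Finset (EuclideanSpace ℝ (Fin n))) (μ : W → ℝ)

/-- The value of the functional `⟨(u, 1), ·⟩` at the lifted point `(w, μ w)`. -/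
noncomputable def liftValue (u : EuclideanSpace ℝ (Fin n)) (w : W) : ℝ :=
  inner ℝ u (w : EuclideanSpace ℝ (Fin n)) + μ w

/-- `w` is the only minimizer of `⟨(u, 1), ·⟩` among the lifted points. -/
def IsUniqueMin (u : EuclideanSpace ℝ (Fin n)) (w : W) : Prop :=
  ∀ w', w' ≠ w → liftValue W μ u w < liftValue W μ u w'

variable {W μ}

lemma IsUniqueMin.eq {u : EuclideanSpace ℝ (Fin n)} {w w' : W} (h : IsUniqueMin W μ u w)
    (h' : IsUniqueMin W μ u w') : w = w' := by
  by_contra hne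
  exact lt_asymm (h w' (Ne.symm hne)) (h' w hne)

lemma IsUniqueMin.le {u : EuclideanSpace ℝ (Fin n)} {w : W} (h : IsUniqueMin W μ u w) (w' : W) :
    liftValue W μ u w ≤ liftValue W μ u w' := by
  by_cases hw : w' = w
  · rw [hw]
  · exact (h w' hw).le

/-- A convex combination attains the minimum only if every point of nonzero weight does. This
reduces faces to comparisons between finitely many lifted points. -/
lemma projFace_liftedPolytope (u : EuclideanSpace ℝ (Fin n)) :
    projFace (liftedPolytope W μ) u =
      convexHull ℝ ((↑) '' {w : W | ∀ w', liftValue W μ u w ≤ liftValue W μ u w'}) := by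
  apply Set.Subset.antisymm
  · rintro _ ⟨x, ⟨hx, hmin⟩, rfl⟩
    obtain ⟨ι, _, c, z, hc, hc1, hz, rfl⟩ := mem_convexHull_iff_exists_fintype.1 hx
    choose k hk using hz
    set ℓ : EuclideanSpace ℝ (Fin n) × ℝ →ₗ[ℝ] ℝ :=
      (innerₛₗ ℝ u).comp (LinearMap.fst ℝ _ ℝ) + LinearMap.snd ℝ _ ℝ with hℓ
    have hℓa : ∀ y, ℓ y = inner ℝ u y.1 + y.2 := fun y => rfl
    have hle : ∀ w, ℓ (∑ i, c i • z i) ≤ liftValue W μ u w := fun w => by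
      rw [hℓa]
      exact hmin _ (subset_convexHull ℝ _ ⟨w, rfl⟩)
    have hval : ∀ i, ℓ (z i) = liftValue W μ u (k i) := fun i => by
      rw [← hk i]
      rfl
    -- The weighted excesses over the minimum are nonnegative and add up to zero, so each of them
    -- vanishes.
    have hsum : ∑ i, c i * (ℓ (z i) - ℓ (∑ i, c i • z i)) = 0 := by
      simp only [mul_sub, Finset.sum_sub_distrib, ← Finset.sum_mul, hc1, one_mul]
      simp [map_sum]
    have hterm := (Finset.sum_eq_zero_iff_of_nonneg fun i _ =>
      mul_nonneg (hc i) (sub_nonneg.2 ((hle (k i)).trans_eq (hval i).symm))).1 hsum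
    have hfst : (∑ i, c i • z i).1 = ∑ᶠ i, c i • (z i).1 := by
      rw [finsum_eq_sum_of_fintype, Prod.fst_sum]
      rfl
    rw [hfst]
    refine (convex_convexHull ℝ _).finsum_mem hc (by rw [finsum_eq_sum_of_fintype, hc1])
      fun i hi => subset_convexHull ℝ _ ⟨k i, fun w' => ?_, by rw [← hk i]⟩
    rcases mul_eq_zero.1 (hterm i (Finset.mem_univ i)) with h | h
    · exact absurd h hi
    · rw [← hval, sub_eq_zero.1 h]
      exact hle w'
  · refine convexHull_min ?_ (convex_projFace (convex_convexHull ℝ _) u)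
    rintro _ ⟨w, hw, rfl⟩
    refine ⟨(w, μ w), ⟨subset_convexHull ℝ _ ⟨w, rfl⟩, ?_⟩, rfl⟩
    have hconv : Convex ℝ {y : EuclideanSpace ℝ (Fin n) × ℝ |
        liftValue W μ u w ≤ inner ℝ u y.1 + y.2} :=
      convex_halfSpace_ge ((innerₛₗ ℝ u).comp (LinearMap.fst ℝ _ ℝ) +
        LinearMap.snd ℝ _ ℝ).isLinear _
    refine fun y hy => convexHull_min ?_ hconv hy
    rintro _ ⟨w', rfl⟩
    exact hw w'

lemma IsUniqueMin.projFace_eq {u : EuclideanSpace ℝ (Fin n)} {w : W} (h : IsUniqueMin W μ u w) :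
    projFace (liftedPolytope W μ) u = {(w : EuclideanSpace ℝ (Fin n))} := by
  have : {w : W | ∀ w', liftValue W μ u w ≤ liftValue W μ u w'} = {w} := by
    ext w'
    refine ⟨fun hw' => ?_, ?_⟩
    · by_contra hne
      exact (h w' hne).not_ge (hw' w)
    · rintro rfl
      exact h.le
  rw [projFace_liftedPolytope, this, Set.image_singleton, convexHull_singleton]

lemma exists_liftValue_le (hW : W.Nonempty) (u : EuclideanSpace ℝ (Fin n)) :
    ∃ w : W, ∀ w', liftValue W μ u w ≤ liftValue W μ u w' :=
  haveI := hW.to_subtype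
  Finite.exists_min (liftValue W μ u)

lemma projFace_liftedPolytope_nonempty (hW : W.Nonempty) (u : EuclideanSpace ℝ (Fin n)) :
    (projFace (liftedPolytope W μ) u).Nonempty := by
  obtain ⟨w, hw⟩ := exists_liftValue_le (μ := μ) hW u
  rw [projFace_liftedPolytope]
  exact ⟨w, subset_convexHull ℝ _ ⟨w, hw, rfl⟩⟩

lemma subsingleton_projFace_iff (hW : W.Nonempty) {u : EuclideanSpace ℝ (Fin n)} :
    (projFace (liftedPolytope W μ) u).Subsingleton ↔ ∃ w, IsUniqueMin W μ u w := by
  constructor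
  · intro hs
    obtain ⟨w, hw⟩ := exists_liftValue_le (μ := μ) hW u
    refine ⟨w, fun w' hne => (hw w').lt_of_ne fun heq => hne ?_⟩
    rw [projFace_liftedPolytope] at hs
    exact Subtype.ext (hs (subset_convexHull ℝ _ ⟨w', fun y => heq ▸ hw y, rfl⟩)
      (subset_convexHull ℝ _ ⟨w, hw, rfl⟩))
  · rintro ⟨w, hw⟩
    rw [hw.projFace_eq]
    exact Set.subsingleton_singleton

variable (W μ) in
/-- The affine function of `u` comparing the values at two lifted points. -/
noncomputable def wall (w w' : W) : EuclideanSpace ℝ (Fin n) →ᵃ[ℝ] ℝ :=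
  (innerₛₗ ℝ ((w : EuclideanSpace ℝ (Fin n)) - w')).toAffineMap +
    AffineMap.const ℝ _ (μ w - μ w')

lemma wall_apply (w w' : W) (u : EuclideanSpace ℝ (Fin n)) :
    wall W μ w w' u = liftValue W μ u w - liftValue W μ u w' := by
  have : wall W μ w w' u = inner ℝ ((w : EuclideanSpace ℝ (Fin n)) - w') u + (μ w - μ w') := rfl
  rw [this, liftValue, liftValue, real_inner_comm, inner_sub_right]
  ring

lemma liftValue_lt_iff {w w' : W} {u : EuclideanSpace ℝ (Fin n)} :
    liftValue W μ u w < liftValue W μ u w' ↔ SignType.sign (wall W μ w w' u) = -1 := by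
  rw [sign_eq_neg_one_iff, wall_apply, sub_neg]

lemma isOpen_setOf_isUniqueMin (w : W) : IsOpen {u | IsUniqueMin W μ u w} := by
  have : {u | IsUniqueMin W μ u w} = ⋂ w' : W, ⋂ _ : w' ≠ w, signSet (wall W μ w w') (-1) := by
    ext u
    simp [IsUniqueMin, liftValue_lt_iff, signSet]
  rw [this]
  exact isOpen_iInter_of_finite fun w' => isOpen_iInter_of_finite fun _ =>
    isOpen_signSet (by decide)

lemma convex_setOf_isUniqueMin (w : W) : Convex ℝ {u | IsUniqueMin W μ u w} := by
  have : {u | IsUniqueMin W μ u w} = ⋂ w' : W, ⋂ _ : w' ≠ w, signSet (wall W μ w w') (-1) := by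
    ext u
    simp [IsUniqueMin, liftValue_lt_iff, signSet]
  rw [this]
  exact convex_iInter fun w' => convex_iInter fun _ => convex_signSet _ _

end SinglePolytope

end MixedSubdivision

namespace MixedSubdivision

/-! ### Vertices of the subdivisions as regions of normal vectors. -/

section Families

variable {n r : ℕ} {W : Fin r → Finset (EuclideanSpace ℝ (Fin n))} {μ : ∀ i, W i → ℝ}

variable (W μ) in
/-- The normal vectors whose unique minimizers are prescribed by `c`. -/
def region (I : Finset (Fin r)) (c : ∀ i : I, W i) : Set (EuclideanSpace ℝ (Fin n)) :=
  {u | ∀ i : I, IsUniqueMin (W i) (μ i) u (c i)}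

lemma isOpen_region (I : Finset (Fin r)) (c : ∀ i : I, W i) : IsOpen (region W μ I c) := by
  have : region W μ I c = ⋂ i : I, {u | IsUniqueMin (W i) (μ i) u (c i)} := by
    ext
    simp [region]
  rw [this]
  exact isOpen_iInter_of_finite fun i => isOpen_setOf_isUniqueMin _

lemma convex_region (I : Finset (Fin r)) (c : ∀ i : I, W i) : Convex ℝ (region W μ I c) := by
  have : region W μ I c = ⋂ i : I, {u | IsUniqueMin (W i) (μ i) u (c i)} := by
    ext
    simp [region]
  rw [this]
  exact convex_iInter fun i => convex_setOf_isUniqueMin _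

lemma projFace_liftedSum (I : Finset (Fin r)) (u : EuclideanSpace ℝ (Fin n)) :
    projFace (liftedSum W μ I) u = ∑ i ∈ I, projFace (liftedPolytope (W i) (μ i)) u :=
  projFace_sum I _ u

lemma projFace_liftedSum_of_mem_region {I : Finset (Fin r)} {c : ∀ i : I, W i}
    {u : EuclideanSpace ℝ (Fin n)} (hu : u ∈ region W μ I c) :
    projFace (liftedSum W μ I) u = {∑ i : I, (c i : EuclideanSpace ℝ (Fin n))} := by
  rw [projFace_liftedSum, ← Finset.sum_coe_sort, ← Set.finsetSum_singleton]
  exact Finset.sum_congr rfl fun i _ => (hu i).projFace_eq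

/-- A Minkowski sum of nonempty sets has at most one point only if each summand does. -/
lemma exists_mem_region (hW : ∀ i, (W i).Nonempty) {I : Finset (Fin r)}
    {u : EuclideanSpace ℝ (Fin n)} (h : (projFace (liftedSum W μ I) u).Subsingleton) :
    ∃ c, u ∈ region W μ I c := by
  have key : ∀ i : I, ∃ w, IsUniqueMin (W i) (μ i) u w := by
    intro i
    rw [← subsingleton_projFace_iff (hW i)]
    intro x hx y hy
    -- Adding a fixed point of the remaining summands injects the `i`-th face into the whole sum.
    rw [projFace_liftedSum, ← Finset.add_sum_erase I _ i.2] at h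
    choose z hz using fun j => projFace_liftedPolytope_nonempty (μ := μ j) (hW j) u
    have hrest := Set.finsetSum_mem_finsetSum (I.erase i)
      (fun j => projFace (liftedPolytope (W j) (μ j)) u) z fun j _ => hz j
    exact add_right_cancel (h (Set.add_mem_add hx hrest) (Set.add_mem_add hy hrest))
  choose c hc using key
  exact ⟨c, hc⟩

lemma vertexSet_eq_image (hW : ∀ i, (W i).Nonempty) (I : Finset (Fin r)) :
    vertexSet W μ I = (fun c : ∀ i : I, W i => ∑ i : I, (c i : EuclideanSpace ℝ (Fin n))) ''
      {c | (region W μ I c).Nonempty} := by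
  ext v
  constructor
  · rintro ⟨u, hu⟩
    obtain ⟨c, hc⟩ := exists_mem_region hW (hu ▸ Set.subsingleton_singleton)
    refine ⟨c, ⟨u, hc⟩, ?_⟩
    rw [projFace_liftedSum_of_mem_region hc] at hu
    exact (Set.singleton_injective hu).symm
  · rintro ⟨c, ⟨u, hu⟩, rfl⟩
    exact ⟨u, (projFace_liftedSum_of_mem_region hu).symm⟩

/-- Summing the strict minimality at `u` leaves only the heights, because equal sums have equal
inner products with `u`. The conclusion no longer involves `u`, so choices from different regions
can be compared. -/
lemma sum_lt_sum_of_mem_region {I : Finset (Fin r)} {c c' : ∀ i : I, W i}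
    {u : EuclideanSpace ℝ (Fin n)} (hu : u ∈ region W μ I c) (hne : c ≠ c')
    (hsum : ∑ i : I, (c i : EuclideanSpace ℝ (Fin n)) = ∑ i : I, (c' i : EuclideanSpace ℝ (Fin n))) :
    ∑ i : I, μ i (c i) < ∑ i : I, μ i (c' i) := by
  obtain ⟨j, hj⟩ := Function.ne_iff.1 hne
  have hlt : ∑ i : I, liftValue (W i) (μ i) u (c i) < ∑ i : I, liftValue (W i) (μ i) u (c' i) :=
    Finset.sum_lt_sum (fun i _ => (hu i).le _) ⟨j, Finset.mem_univ _, hu j _ (Ne.symm hj)⟩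
  simp only [liftValue, Finset.sum_add_distrib, ← inner_sum, hsum] at hlt
  linarith

lemma injOn_sum_region (I : Finset (Fin r)) :
    Set.InjOn (fun c : ∀ i : I, W i => ∑ i : I, (c i : EuclideanSpace ℝ (Fin n)))
      {c | (region W μ I c).Nonempty} := by
  rintro c ⟨u, hu⟩ c' ⟨u', hu'⟩ h
  by_contra hne
  exact lt_asymm (sum_lt_sum_of_mem_region hu hne h)
    (sum_lt_sum_of_mem_region hu' (Ne.symm hne) h.symm)

lemma finite_vertexSet (hW : ∀ i, (W i).Nonempty) (I : Finset (Fin r)) :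
    (vertexSet W μ I).Finite := by
  rw [vertexSet_eq_image hW]
  exact (Set.toFinite _).image _

/-- The number of vertices as a sum of Euler characteristics of regions. -/
lemma ncard_vertexSet (hW : ∀ i, (W i).Nonempty) (I : Finset (Fin r)) :
    (-1) ^ n * ((vertexSet W μ I).ncard : ℤ) = ∑ c, eulerChar (region W μ I c) := by
  classical
  rw [vertexSet_eq_image hW, (injOn_sum_region I).ncard_image, Set.ncard_eq_toFinset_card',
    Finset.cast_card, Finset.mul_sum, ← Finset.sum_subset (Finset.subset_univ _)]
  · refine Finset.sum_congr rfl fun c hc => ?_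
    -- Nonempty regions are open in `ℝⁿ` and count `(-1)^n` each; empty ones count `0`.
    rw [eulerChar_of_isOpen (isOpen_region I c) (by simpa using hc), finrank_euclideanSpace_fin,
      mul_one]
  · intro c _ hc
    have : region W μ I c = ∅ := Set.not_nonempty_iff_eq_empty.1 (by simpa using hc)
    rw [this, eulerChar_empty]

/-! ### Inclusion-exclusion on the faces of the wall arrangement. -/

variable (W μ) in
/-- The common points of the tropical hypersurfaces: the normal vectors for which no minimizer is
unique. -/
def tropicalIntersection : Set (EuclideanSpace ℝ (Fin n)) :=
  {u | ∀ i, ¬ ∃ w, IsUniqueMin (W i) (μ i) u w}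

variable (W μ) in
/-- The signs of all comparisons between the values at lifted points. -/
noncomputable def signVector (u : EuclideanSpace ℝ (Fin n)) : (Σ i, W i × W i) → SignType :=
  fun k => SignType.sign (wall (W k.1) (μ k.1) k.2.1 k.2.2 u)

lemma liftValue_lt_iff_of_signVector_eq {u u' : EuclideanSpace ℝ (Fin n)}
    (h : signVector W μ u = signVector W μ u') (i : Fin r) (w w' : W i) :
    liftValue (W i) (μ i) u w < liftValue (W i) (μ i) u w' ↔
      liftValue (W i) (μ i) u' w < liftValue (W i) (μ i) u' w' := by
  rw [liftValue_lt_iff, liftValue_lt_iff]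
  exact (congrArg (· = -1) (congrFun h ⟨i, w, w'⟩)).to_iff

lemma isUniqueMin_iff_of_signVector_eq {u u' : EuclideanSpace ℝ (Fin n)}
    (h : signVector W μ u = signVector W μ u') (i : Fin r) (w : W i) :
    IsUniqueMin (W i) (μ i) u w ↔ IsUniqueMin (W i) (μ i) u' w :=
  forall₂_congr fun w' _ => liftValue_lt_iff_of_signVector_eq h i w w'

/-- The minimizers depend only on the signs of the comparisons, so the dual cell is constant on each
face of the arrangement. -/
lemma projFace_liftedSum_of_signVector_eq {u u' : EuclideanSpace ℝ (Fin n)}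
    (h : signVector W μ u = signVector W μ u') (I : Finset (Fin r)) :
    projFace (liftedSum W μ I) u = projFace (liftedSum W μ I) u' := by
  rw [projFace_liftedSum, projFace_liftedSum]
  refine Finset.sum_congr rfl fun i _ => ?_
  simp only [projFace_liftedPolytope, ← not_lt, liftValue_lt_iff_of_signVector_eq h]

open scoped Classical in
/-- The part of a region in a face of the arrangement is the face or empty. -/
lemma eulerChar_region_inter (I : Finset (Fin r)) (c : ∀ i : I, W i)
    (u : EuclideanSpace ℝ (Fin n)) :
    eulerChar (region W μ I c ∩ {x | signVector W μ x = signVector W μ u}) =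
      eulerChar {x | signVector W μ x = signVector W μ u} *
        ∏ i : I, if IsUniqueMin (W i) (μ i) u (c i) then 1 else 0 := by
  have hinv : ∀ x, signVector W μ x = signVector W μ u →
      (x ∈ region W μ I c ↔ u ∈ region W μ I c) := fun x hx =>
    forall_congr' fun i => isUniqueMin_iff_of_signVector_eq hx i (c i)
  by_cases hu : u ∈ region W μ I c
  · have hsub : {x | signVector W μ x = signVector W μ u} ⊆ region W μ I c := fun x hx =>
      (hinv x hx).2 hu
    rw [Set.inter_eq_right.2 hsub, Finset.prod_eq_one, mul_one]
    exact fun i _ => if_pos (hu i)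
  · have hemp : region W μ I c ∩ {x | signVector W μ x = signVector W μ u} = ∅ := by
      ext x
      simp only [Set.mem_inter_iff, Set.mem_empty_iff_false, iff_false, not_and]
      exact fun hx hs => hu ((hinv x hs).1 hx)
    obtain ⟨i, hi⟩ := not_forall.1 hu
    rw [hemp, eulerChar_empty, Finset.prod_eq_zero (Finset.mem_univ i) (if_neg hi), mul_zero]

open scoped Classical in
lemma sum_ite_isUniqueMin (i : Fin r) (u : EuclideanSpace ℝ (Fin n)) :
    (∑ w, if IsUniqueMin (W i) (μ i) u w then (1 : ℤ) else 0) =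
      if ∃ w, IsUniqueMin (W i) (μ i) u w then 1 else 0 := by
  split_ifs with h
  · obtain ⟨w, hw⟩ := h
    rw [Finset.sum_eq_single w, if_pos hw]
    · exact fun w' _ hne => if_neg fun hw' => hne (hw'.eq hw)
    · simp
  · exact Finset.sum_eq_zero fun w _ => if_neg fun hw => h ⟨w, hw⟩

open scoped Classical in
/-- The inclusion-exclusion principle on a face of the arrangement. -/
lemma sum_eulerChar_region_inter (u : EuclideanSpace ℝ (Fin n)) :
    ∑ I : Finset (Fin r), (-1 : ℤ) ^ I.card *
        ∑ c, eulerChar (region W μ I c ∩ {x | signVector W μ x = signVector W μ u}) =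
      if u ∈ tropicalIntersection W μ then
        eulerChar {x | signVector W μ x = signVector W μ u} else 0 := by
  set e := eulerChar {x | signVector W μ x = signVector W μ u}
  set g : Fin r → ℤ := fun i => if ∃ w, IsUniqueMin (W i) (μ i) u w then 1 else 0 with hg
  -- Summing over all choices `c` factors as a product over `i ∈ I`, and the sign `(-1)^|I|` is
  -- absorbed into the factors.
  have hI : ∀ I : Finset (Fin r), (-1 : ℤ) ^ I.card *
      ∑ c, eulerChar (region W μ I c ∩ {x | signVector W μ x = signVector W μ u}) =
        e * ∏ i ∈ I, -g i := by
    intro I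
    simp only [eulerChar_region_inter, ← Finset.mul_sum]
    rw [← Fintype.prod_sum (fun (i : I) (w : W i) =>
      if IsUniqueMin (W i) (μ i) u w then (1 : ℤ) else 0)]
    simp only [sum_ite_isUniqueMin]
    rw [Finset.prod_coe_sort I g, Finset.prod_neg]
    ring
  rw [Finset.sum_congr rfl fun I _ => hI I, ← Finset.mul_sum, ← Finset.powerset_univ,
    ← Finset.prod_one_add]
  split_ifs with hu
  · rw [Finset.prod_eq_one, mul_one]
    intro i _
    rw [hg]
    dsimp only
    rw [if_neg (hu i), neg_zero, add_zero]
  · simp only [tropicalIntersection, Set.mem_ofPred_eq, not_forall, not_not] at hu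
    obtain ⟨i, hi⟩ := hu
    rw [Finset.prod_eq_zero (Finset.mem_univ i), mul_zero]
    rw [hg]
    dsimp only
    rw [if_pos hi, add_neg_cancel]

/-- If the signs separate the points of the tropical intersection, then the number of these points
is an alternating sum of numbers of vertices. -/
lemma sum_ncard_vertexSet (hW : ∀ i, (W i).Nonempty)
    (hinj : ∀ u ∈ tropicalIntersection W μ, ∀ x, signVector W μ x = signVector W μ u → x = u) :
    ∑ I : Finset (Fin r), (-1 : ℤ) ^ I.card * ((-1) ^ n * ((vertexSet W μ I).ncard : ℤ)) =
      ((tropicalIntersection W μ).ncard : ℤ) := by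
  classical
  have hcut : ∀ (I : Finset (Fin r)) (c : ∀ i : I, W i), eulerChar (region W μ I c) =
      ∑ σ, eulerChar (region W μ I c ∩ {x | signVector W μ x = σ}) := by
    intro I c
    rw [eulerChar_eq_sum_arrangement
      (fun k : Σ i, W i × W i => wall (W k.1) (μ k.1) k.2.1 k.2.2)
      ⟨⊤, region W μ I c, isOpen_region I c, convex_region I c, by simp⟩]
    simp only [signVector, funext_iff]
  -- By `hinj`, a face meeting the tropical intersection is a single point and contributes `1`; all
  -- other sign vectors contribute `0`.
  have hface : ∀ σ, ∑ I : Finset (Fin r), (-1 : ℤ) ^ I.card *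
      ∑ c, eulerChar (region W μ I c ∩ {x | signVector W μ x = σ}) =
        if σ ∈ signVector W μ '' tropicalIntersection W μ then 1 else 0 := by
    intro σ
    by_cases hσ : ∃ u, signVector W μ u = σ
    · obtain ⟨u, rfl⟩ := hσ
      rw [sum_eulerChar_region_inter]
      by_cases hu : u ∈ tropicalIntersection W μ
      · have : {x | signVector W μ x = signVector W μ u} = {u} := by
          ext x
          exact ⟨hinj u hu x, fun h => congrArg _ h⟩
        rw [if_pos hu, if_pos ⟨u, hu, rfl⟩, this, eulerChar_singleton]
      · rw [if_neg hu, if_neg]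
        rintro ⟨x, hx, hxu⟩
        exact hu (hinj x hx u hxu.symm ▸ hx)
    · have hemp : {x | signVector W μ x = σ} = ∅ := by
        ext x
        simpa using fun h => hσ ⟨x, h⟩
      rw [if_neg fun ⟨x, _, hx⟩ => hσ ⟨x, hx⟩]
      simp [hemp, eulerChar_empty]
  have hncard : (signVector W μ '' tropicalIntersection W μ).ncard =
      (tropicalIntersection W μ).ncard :=
    Set.InjOn.ncard_image fun x _ y hy h => hinj y hy x h
  simp only [ncard_vertexSet hW, hcut]
  rw [← hncard, Set.ncard_eq_toFinset_card', Finset.cast_card]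
  calc _ = ∑ I : Finset (Fin r), ∑ σ, (-1 : ℤ) ^ I.card *
        ∑ c, eulerChar (region W μ I c ∩ {x | signVector W μ x = σ}) :=
      Finset.sum_congr rfl fun I _ => by rw [Finset.sum_comm, Finset.mul_sum]
    _ = _ := by
      rw [Finset.sum_comm, Finset.sum_congr rfl fun σ _ => hface σ, ← Finset.sum_filter]
      exact Finset.sum_congr (by ext; simp) fun _ _ => rfl

end Families

/-! ### Purity: mixed polytopes as points of the tropical intersection. -/

section Square

variable {n : ℕ} {W : Fin n → Finset (EuclideanSpace ℝ (Fin n))} {μ : ∀ i, W i → ℝ}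

lemma one_le_polyDim_projFace_iff (hW : ∀ i, (W i).Nonempty) {u : EuclideanSpace ℝ (Fin n)} :
    (∀ i, 1 ≤ polyDim (projFace (liftedPolytope (W i) (μ i)) u)) ↔
      u ∈ tropicalIntersection W μ :=
  forall_congr' fun i => by rw [one_le_polyDim_iff, subsingleton_projFace_iff (hW i)]

/-- In the pure case the cells dual to the points of the tropical intersection span `ℝⁿ`. -/
lemma IsPure.le_polyDim (hpure : IsPure W μ) (hW : ∀ i, (W i).Nonempty)
    {u : EuclideanSpace ℝ (Fin n)} (hu : u ∈ tropicalIntersection W μ) :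
    n ≤ polyDim (projFace (liftedSum W μ Finset.univ) u) := by
  rw [hpure _ _ ⟨u, rfl, fun i => rfl⟩]
  calc n = ∑ _i : Fin n, 1 := by simp
    _ ≤ _ := Finset.sum_le_sum fun i _ => (one_le_polyDim_projFace_iff hW).2 hu i

lemma IsPure.injOn_projFace (hpure : IsPure W μ) (hW : ∀ i, (W i).Nonempty) :
    Set.InjOn (projFace (liftedSum W μ Finset.univ)) (tropicalIntersection W μ) :=
  fun _ hu _ _ h => eq_of_projFace_eq h (hpure.le_polyDim hW hu)

/-- Having no unique minimizer for any `i` means that every summand has positive dimension; purity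
supplies the additivity of dimensions. -/
lemma IsPure.mixedPolytopes_eq_image (hpure : IsPure W μ) (hW : ∀ i, (W i).Nonempty) :
    mixedPolytopes W μ = projFace (liftedSum W μ Finset.univ) '' tropicalIntersection W μ := by
  ext Q
  constructor
  · rintro ⟨Qs, ⟨u, rfl, hQs⟩, -, h1⟩
    exact ⟨u, (one_le_polyDim_projFace_iff hW).1 fun i => hQs i ▸ h1 i, rfl⟩
  · rintro ⟨u, hu, rfl⟩
    have hcell : IsCellWithSummands W μ (projFace (liftedSum W μ Finset.univ) u)
      fun i => projFace (liftedPolytope (W i) (μ i)) u := ⟨u, rfl, fun i => rfl⟩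
    exact ⟨_, hcell, hpure _ _ hcell, (one_le_polyDim_projFace_iff hW).2 hu⟩

/-- Equal signs give equal dual cells, and a full-dimensional cell has only one normal vector. -/
lemma IsPure.eq_of_signVector_eq (hpure : IsPure W μ) (hW : ∀ i, (W i).Nonempty)
    {u x : EuclideanSpace ℝ (Fin n)} (hu : u ∈ tropicalIntersection W μ)
    (h : signVector W μ x = signVector W μ u) : x = u :=
  (eq_of_projFace_eq (projFace_liftedSum_of_signVector_eq h.symm _)
    (hpure.le_polyDim hW hu)).symm

lemma IsPure.finite_tropicalIntersection (hpure : IsPure W μ) (hW : ∀ i, (W i).Nonempty) :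
    (tropicalIntersection W μ).Finite :=
  Set.Finite.of_finite_image (Set.toFinite (signVector W μ '' _))
    fun _ _ _ hy h => hpure.eq_of_signVector_eq hW hy h

end Square

end MixedSubdivision

theorem propositionP (n : ℕ) (W : Fin n → Finset (EuclideanSpace ℝ (Fin n)))
    (hW : ∀ i, (W i).Nonempty) (μ : ∀ i, W i → ℝ) (hpure : MixedSubdivision.IsPure W μ) :
    (∀ I : Finset (Fin n), (MixedSubdivision.vertexSet W μ I).Finite) ∧
    (MixedSubdivision.mixedPolytopes W μ).Finite ∧
    ∑ I : Finset (Fin n), (-1 : ℤ) ^ (n - I.card) * ((MixedSubdivision.vertexSet W μ I).ncard : ℤ) =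
      ((MixedSubdivision.mixedPolytopes W μ).ncard : ℤ) := by
  refine ⟨MixedSubdivision.finite_vertexSet hW, ?_, ?_⟩
  · rw [hpure.mixedPolytopes_eq_image hW]
    exact (hpure.finite_tropicalIntersection hW).image _
  · rw [hpure.mixedPolytopes_eq_image hW, (hpure.injOn_projFace hW).ncard_image,
      ← MixedSubdivision.sum_ncard_vertexSet hW fun u hu x hx => hpure.eq_of_signVector_eq hW hu hx]
    refine Finset.sum_congr rfl fun I _ => ?_
    -- The bound `k ≤ n` keeps the natural subtraction from truncating; the two factors `(-1)^k`
    -- then cancel.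
    have hsign : ∀ k ≤ n, (-1 : ℤ) ^ (n - k) = (-1) ^ k * (-1) ^ n := by
      intro k hk
      obtain ⟨m, rfl⟩ := Nat.exists_eq_add_of_le hk
      rw [Nat.add_sub_cancel_left, pow_add, ← mul_assoc, ← pow_add, Even.neg_one_pow ⟨k, rfl⟩,
        one_mul]
    rw [hsign _ (by simpa using I.card_le_univ), mul_assoc]
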